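/- Let $(R,\mathfrak m,k)$ be a commutative noetherian local ring that is Cohen–Macaulay (i.e. $\operatorname{depth}R=\dim R$), and let $\Omega$ be a dualizing module for $R$, that is, a finitely generated $R$-module of finite injective dimension such that $\operatorname{Ext}^i_R(\Omega,\Omega)=0$ for all $i>0$ and the homothety map $R\to\operatorname{Hom}_R(\Omega,\Omega)$, $r\mapsto(t\mapsto rt)$, is an isomorphism. Let $\mathcal P$ and $\mathcal I$ be the full subcategories of the category of $R$-modules whose objects are the finitely generated modules of finite projective dimension and the finitely generated modules of finite injective dimension, respectively (the zero module belongs to both). Then $\Omega\otimes_R M\in\mathcal I$ for every $M\in\mathcal P$, $\operatorname{Hom}_R(\Omega,N)\in\mathcal P$ for every $N\in\mathcal I$, and the adjunction obtained by restricting the tensor–hom adjunction, $$\Omega\otimes_R-\colon\ \mathcal P\ \rightleftarrows\ \mathcal I\ :\operatorname{Hom}_R(\Omega,-),$$ is an adjoint equivalence. In other words, the unit $M\to\operatorname{Hom}_R(\Omega,\Omega\otimes_R M)$, $m\mapsto(t\mapsto t\otimes m)$, is an isomorphism for every $M\in\mathcal P$, and the counit $\Omega\otimes_R\operatorname{Hom}_R(\Omega,N)\to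 N$, $t\otimes\beta\mapsto\beta(t)$, is an isomorphism for every $N\in\mathcal I$. -/

import Mathlib

open CategoryTheory MonoidalCategory

universe u

namespace SharpEquivalence

noncomputable section

/-- The depth of a local ring `R`: the supremum of the lengths of the `R`-regular sequences
contained in the maximal ideal. -/
def depth (R : Type u) [CommRing R] [IsLocalRing R] : ℕ∞ :=
  ⨆ rs : {rs : List R //
    (∀ r ∈ rs, r ∈ IsLocalRing.maximalIdeal R) ∧ RingTheory.Sequence.IsRegular R rs},
    (rs.1.length : ℕ∞)

/-- A (commutative noetherian) local ring is Cohen-Macaulay if its depth equals its Krull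
dimension. -/
def IsCohenMacaulay (R : Type u) [CommRing R] [IsLocalRing R] : Prop :=
  ((depth R : ℕ∞) : WithBot ℕ∞) = ringKrullDim R

variable {R : Type u} [CommRing R]

/-- A dualizing module: a semidualizing module (that is, a finitely generated module whose
homothety map `R → Hom_R(Ω, Ω)` is an isomorphism and for which `Ext^i_R(Ω, Ω) = 0` for all
`i > 0`) of finite injective dimension. -/
structure IsDualizingModule (Ω : ModuleCat.{u} R) : Prop where
  finite : Module.Finite R Ω
  homothety_bijective : Function.Bijective (fun r : R => (r • LinearMap.id : Ω →ₗ[R] Ω))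
  ext_eq_zero : ∀ i : ℕ, 0 < i → Subsingleton (Abelian.Ext.{u} Ω Ω i)
  injectiveDimension_ne_top : injectiveDimension Ω ≠ ⊤

variable (R) in
/-- The finitely generated `R`-modules of finite projective dimension. The zero module, whose
projective dimension is `⊥`, is one of them. -/
def fgFiniteProjDim : ObjectProperty (ModuleCat.{u} R) :=
  fun M => Module.Finite R M ∧ projectiveDimension M ≠ ⊤

variable (R) in
/-- The finitely generated `R`-modules of finite injective dimension (as objects of the category
of all `R`-modules). The zero module, whose injective dimension is `⊥`, is one of them. -/
def fgFiniteInjDim : ObjectProperty (ModuleCat.{u} R) :=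
  fun M => Module.Finite R M ∧ injectiveDimension M ≠ ⊤

/-- The functor `Ω ⊗_R -`, restricted to full subcategories `P` and `Q` of the category of
`R`-modules. -/
abbrev tensorFunctor (Ω : ModuleCat.{u} R) (P Q : ObjectProperty (ModuleCat.{u} R))
    (hF : ∀ M : ModuleCat.{u} R, P M → Q ((tensorLeft Ω).obj M)) :
    P.FullSubcategory ⥤ Q.FullSubcategory :=
  Q.lift (P.ι ⋙ tensorLeft Ω) (fun M => hF M.obj M.property)

/-- The functor `Hom_R(Ω, -)`, restricted to full subcategories `Q` and `P` of the category of
`R`-modules. -/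
abbrev homFunctor (Ω : ModuleCat.{u} R) (P Q : ObjectProperty (ModuleCat.{u} R))
    (hG : ∀ N : ModuleCat.{u} R, Q N → P ((ihom Ω).obj N)) :
    Q.FullSubcategory ⥤ P.FullSubcategory :=
  P.lift (Q.ι ⋙ ihom Ω) (fun N => hG N.obj N.property)

/-- The restriction of the tensor-hom adjunction, with unit `m ↦ (t ↦ t ⊗ m)` and counit
`t ⊗ β ↦ β t`, to full subcategories that are exchanged by the two functors. -/
def tensorHomAdjunction (Ω : ModuleCat.{u} R) (P Q : ObjectProperty (ModuleCat.{u} R))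
    (hF : ∀ M : ModuleCat.{u} R, P M → Q ((tensorLeft Ω).obj M))
    (hG : ∀ N : ModuleCat.{u} R, Q N → P ((ihom Ω).obj N)) :
    tensorFunctor Ω P Q hF ⊣ homFunctor Ω P Q hG :=
  (ihom.adjunction Ω).restrictFullyFaithful P.fullyFaithfulι Q.fullyFaithfulι
    (Iso.refl _) (Iso.refl _)

/-- An adjunction is an adjoint equivalence if its unit and its counit are isomorphisms of
functors. -/
def IsAdjointEquivalence {C D : Type*} [Category* C] [Category* D] {F : C ⥤ D} {G : D ⥤ C}
    (adj : F ⊣ G) : Prop :=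
  IsIso adj.unit ∧ IsIso adj.counit

end

end SharpEquivalence

namespace SharpEquivalence

/-! ### Long exact sequences of Ext, and Nakayama -/

section ExtVanishing

open Abelian

variable {R : Type u} [CommRing R] {S : ShortComplex (ModuleCat.{u} R)}

/-! Unit. It is bijective at `R` by the homothety isomorphism, hence at finite free modules. Induct
on projective dimension along `0 → K → F → M → 0`, carrying along `Ext^i(Ω, Ω ⊗ M) = 0` for `i > 0`
and finite injective dimension of `Ω ⊗ M`. The crux is that `Ω ⊗ K → Ω ⊗ F` stays injective
(`IsTensorAcyclic.lTensor_injective`): the units at `K` and `F` show that its kernel admits no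
nonzero map from the faithful module `Ω`.

Counit. First, `Ext^j(Ω, N) = 0` for `j > 0` (`IsDualizingModule.subsingleton_ext`). If `M` is `R`
modulo a maximal regular sequence of length `i`, then `k` embeds in `M` and `pd M ≤ i`, which forces
`Ext^j(-, N) = 0` on finitely generated modules for `j > i`; the sequence is also regular on `Ω`,
and Nakayama carries the vanishing from `Ω ⊗ M` to `Ω` with a shift by `i`. For `I` injective, `Ω ⊗
Hom(Ω, I) ≅ Hom(Hom(Ω, Ω), I) ≅ I`. For general `N`, induct on injective dimension along `0 → N → I
→ Z → 0`: `Hom(Ω, -)` keeps it exact, and so does tensoring back, since `Tor₁(Ω, Hom(Ω, Z)) = 0`.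

The Tor statement that makes this induction work is `TorVanishes Ω 0 (Hom(Ω, N))`. Passing to
syzygies until the degree bound reaches the injective dimension of `Ω` gives flatness, so it also
bounds the projective dimension of `Hom(Ω, N)`. -/

lemma subsingleton_ext_of_iso {X X' Y Y' : ModuleCat.{u} R} (e : X ≅ X') (e' : Y ≅ Y') {n : ℕ}
    (h : Subsingleton (Ext.{u} X Y n)) : Subsingleton (Ext.{u} X' Y' n) := by
  refine subsingleton_of_forall_eq 0 fun z ↦ ?_
  have h0 : ((Ext.mk₀ e.hom).comp z (zero_add n)).comp (Ext.mk₀ e'.inv) (add_zero n) = 0 :=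
    Subsingleton.elim _ _
  have h1 : (Ext.mk₀ e.hom).comp z (zero_add n) = 0 := by
    have := congrArg (fun w ↦ w.comp (Ext.mk₀ e'.hom) (add_zero n)) h0
    simpa using this
  have := congrArg (fun w ↦ (Ext.mk₀ e.inv).comp w (zero_add n)) h1
  simpa using this

lemma subsingleton_ext_X₂ (hS : S.ShortExact) (X : ModuleCat.{u} R) {n : ℕ}
    (h₁ : Subsingleton (Ext.{u} X S.X₁ n)) (h₃ : Subsingleton (Ext.{u} X S.X₃ n)) :
    Subsingleton (Ext.{u} X S.X₂ n) := by
  refine subsingleton_of_forall_eq 0 fun z ↦ ?_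
  obtain ⟨w, rfl⟩ := Ext.covariant_sequence_exact₂ X hS z (Subsingleton.elim _ _)
  rw [Subsingleton.elim w 0, Ext.zero_comp]

lemma subsingleton_ext_X₃ (hS : S.ShortExact) (X : ModuleCat.{u} R) {n : ℕ}
    (h₂ : Subsingleton (Ext.{u} X S.X₂ n)) (h₁ : Subsingleton (Ext.{u} X S.X₁ (n + 1))) :
    Subsingleton (Ext.{u} X S.X₃ n) := by
  refine subsingleton_of_forall_eq 0 fun z ↦ ?_
  obtain ⟨w, rfl⟩ := Ext.covariant_sequence_exact₃ X hS z rfl (Subsingleton.elim _ _)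
  rw [Subsingleton.elim w 0, Ext.zero_comp]

lemma subsingleton_ext_X₁_left (hS : S.ShortExact) (Y : ModuleCat.{u} R) {n : ℕ}
    (h₂ : Subsingleton (Ext.{u} S.X₂ Y n)) (h₃ : Subsingleton (Ext.{u} S.X₃ Y (n + 1))) :
    Subsingleton (Ext.{u} S.X₁ Y n) := by
  refine subsingleton_of_forall_eq 0 fun z ↦ ?_
  obtain ⟨w, rfl⟩ := Ext.contravariant_sequence_exact₁ hS Y z (add_comm 1 n)
    (Subsingleton.elim _ _)
  rw [Subsingleton.elim w 0, Ext.comp_zero]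

lemma subsingleton_ext_X₂_left (hS : S.ShortExact) (Y : ModuleCat.{u} R) {n : ℕ}
    (h₁ : Subsingleton (Ext.{u} S.X₁ Y n)) (h₃ : Subsingleton (Ext.{u} S.X₃ Y n)) :
    Subsingleton (Ext.{u} S.X₂ Y n) := by
  refine subsingleton_of_forall_eq 0 fun z ↦ ?_
  obtain ⟨w, rfl⟩ := Ext.contravariant_sequence_exact₂ hS Y z (Subsingleton.elim _ _)
  rw [Subsingleton.elim w 0, Ext.comp_zero]

lemma exists_lift_of_subsingleton_ext (hS : S.ShortExact) {X : ModuleCat.{u} R}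
    (h : Subsingleton (Ext.{u} X S.X₁ 1)) (f : X ⟶ S.X₃) : ∃ g : X ⟶ S.X₂, g ≫ S.g = f := by
  obtain ⟨w, hw⟩ := Ext.covariant_sequence_exact₃ X hS (Ext.mk₀ f) (zero_add 1)
    (Subsingleton.elim _ _)
  obtain ⟨g, rfl⟩ := Ext.homEquiv₀.symm.surjective w
  refine ⟨g, Ext.homEquiv₀.symm.injective ?_⟩
  simpa using hw

lemma exists_extension_of_subsingleton_ext (hS : S.ShortExact) {Y : ModuleCat.{u} R}
    (h : Subsingleton (Ext.{u} S.X₃ Y 1)) (f : S.X₁ ⟶ Y) : ∃ g : S.X₂ ⟶ Y, S.f ≫ g = f := by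
  obtain ⟨w, hw⟩ := Ext.contravariant_sequence_exact₁ hS Y (Ext.mk₀ f) (add_zero 1)
    (Subsingleton.elim _ _)
  obtain ⟨g, rfl⟩ := Ext.homEquiv₀.symm.surjective w
  refine ⟨g, Ext.homEquiv₀.symm.injective ?_⟩
  simpa using hw

/-- If multiplication by an element `x` of the maximal ideal is injective on `X` with cokernel
`C`, then the vanishing of `Ext^{n+1}(C, Y)` implies that of `Ext^n(X, Y)`. -/
lemma subsingleton_ext_of_subsingleton_ext_cokernel_smul [IsLocalRing R] [IsNoetherianRing R]
    {X C Y : ModuleCat.{u} R} [Module.Finite R X] [Module.Finite R Y] {x : R}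
    (hx : x ∈ IsLocalRing.maximalIdeal R) (p : X ⟶ C) (w : (x • 𝟙 X) ≫ p = 0)
    (hS : (ShortComplex.mk (x • 𝟙 X) p w).ShortExact) {n : ℕ}
    (h : Subsingleton (Ext.{u} C Y (n + 1))) : Subsingleton (Ext.{u} X Y n) := by
  -- Multiplication by `x` is surjective on this finitely generated Ext module, so Nakayama kills
  -- it.
  have hfin : Module.Finite R (Ext.{u} X Y n) := inferInstance
  rw [← Submodule.subsingleton_iff R, ← subsingleton_iff_bot_eq_top, eq_comm]
  refine Submodule.eq_bot_of_le_smul_of_le_jacobson_bot (Ideal.span {x}) ⊤ Module.Finite.fg_top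
    (fun z _ ↦ ?_) ?_
  · obtain ⟨v, hv⟩ := Ext.contravariant_sequence_exact₁ hS Y z (add_comm 1 n)
      (Subsingleton.elim (α := Ext.{u} C Y (n + 1)) _ _)
    have : x • v = z := by
      rw [← hv]
      simp [Ext.mk₀_smul]
    rw [← this]
    exact Submodule.smul_mem_smul (Ideal.mem_span_singleton_self x) trivial
  · rw [Ideal.span_singleton_le_iff_mem, IsLocalRing.jacobson_eq_maximalIdeal ⊥ bot_ne_top]
    exact hx

end ExtVanishing

section ShortExact

variable {R : Type u} [CommRing R] {A B C : Type u} [AddCommGroup A] [Module R A]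
  [AddCommGroup B] [Module R B] [AddCommGroup C] [Module R C]

lemma shortExact_moduleCatMk {f : A →ₗ[R] B} {g : B →ₗ[R] C} (hf : Function.Injective f)
    (hfg : Function.Exact f g) (hg : Function.Surjective g) :
    (ShortComplex.moduleCatMk f g hfg.linearMap_comp_eq_zero).ShortExact :=
  ModuleCat.shortComplex_shortExact _ hfg hf hg

end ShortExact

/-! ### The unit on modules of finite projective dimension -/

section TensorAcyclic

open Abelian TensorProduct

variable {R : Type u} [CommRing R] (Ω : ModuleCat.{u} R)

/-- The modules `M` for which `M → Hom(Ω, Ω ⊗ M)` is an isomorphism, `Ext^i(Ω, Ω ⊗ M) = 0` for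
all `i > 0`, and `Ω ⊗ M` has finite injective dimension. -/
structure IsTensorAcyclic (M : Type u) [AddCommGroup M] [Module R M] : Prop where
  bijective : Function.Bijective (TensorProduct.mk R Ω M).flip
  ext_eq_zero : ∀ i : ℕ, 0 < i → Subsingleton (Ext.{u} Ω (ModuleCat.of R (Ω ⊗[R] M)) i)
  exists_injectiveDimension : ∃ n, HasInjectiveDimensionLT (ModuleCat.of R (Ω ⊗[R] M)) n

variable {Ω} {K F M : Type u} [AddCommGroup K] [Module R K] [AddCommGroup F] [Module R F]
  [AddCommGroup M] [Module R M]

lemma IsDualizingModule.annihilator_eq_bot (hΩ : IsDualizingModule Ω) :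
    Module.annihilator R Ω = ⊥ := by
  refine (Submodule.eq_bot_iff _).2 fun r hr ↦ hΩ.homothety_bijective.1 ?_
  ext t
  have := Module.mem_annihilator.1 hr t
  exact this.trans (zero_smul R t).symm

/-- `Hom(Ω, M) = 0` forces the annihilator of `Ω` to contain an `M`-regular element; that
annihilator is zero, and `0` is regular only on the zero module. -/
lemma IsDualizingModule.subsingleton_of_subsingleton_hom [IsNoetherianRing R]
    (hΩ : IsDualizingModule Ω) [Module.Finite R M] (h : Subsingleton (Ω →ₗ[R] M)) :
    Subsingleton M := by
  have := hΩ.finite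
  obtain ⟨r, hr, hreg⟩ := IsSMulRegular.subsingleton_linearMap_iff.1 h
  rw [hΩ.annihilator_eq_bot, Submodule.mem_bot] at hr
  subst hr
  exact ⟨fun a b ↦ hreg (by simp)⟩

/-- A map from `Ω` into the kernel has the form `t ↦ t ⊗ k` because the unit at `K` is surjective.
Then `t ⊗ f k = 0` for all `t`, so `f k = 0` by injectivity of the unit at `F`, and `k = 0`. Hence
the kernel receives only the zero map from `Ω`. -/
lemma IsTensorAcyclic.lTensor_injective [IsNoetherianRing R] (hΩ : IsDualizingModule Ω)
    [Module.Finite R K] (hK : IsTensorAcyclic Ω K) (hF : IsTensorAcyclic Ω F) {f : K →ₗ[R] F}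
    (hf : Function.Injective f) : Function.Injective (f.lTensor Ω) := by
  have := hΩ.finite
  rw [← LinearMap.ker_eq_bot, ← Submodule.subsingleton_iff_eq_bot]
  refine hΩ.subsingleton_of_subsingleton_hom (subsingleton_of_forall_eq 0 fun h ↦ ?_)
  obtain ⟨k, hk⟩ := hK.bijective.2 ((LinearMap.ker (f.lTensor Ω)).subtype ∘ₗ h)
  have hk0 : k = 0 := by
    refine hf (hF.bijective.1 ?_)
    ext t
    have h1 : t ⊗ₜ[R] k = (h t : Ω ⊗[R] K) := congrArg (fun l : Ω →ₗ[R] Ω ⊗[R] K ↦ l t) hk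
    have h2 : f.lTensor Ω (t ⊗ₜ[R] k) = 0 := by rw [h1]; exact (h t).2
    simpa using h2
  ext t
  have h1 : t ⊗ₜ[R] k = (h t : Ω ⊗[R] K) := congrArg (fun l : Ω →ₗ[R] Ω ⊗[R] K ↦ l t) hk
  rw [← h1, hk0]
  simp

lemma IsTensorAcyclic.shortExact_lTensor [IsNoetherianRing R] (hΩ : IsDualizingModule Ω)
    [Module.Finite R K] (hK : IsTensorAcyclic Ω K) (hF : IsTensorAcyclic Ω F) {f : K →ₗ[R] F}
    {g : F →ₗ[R] M} (hf : Function.Injective f) (hfg : Function.Exact f g)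
    (hg : Function.Surjective g) :
    (ShortComplex.moduleCatMk (f.lTensor Ω) (g.lTensor Ω)
      (lTensor_exact Ω hfg hg).linearMap_comp_eq_zero).ShortExact :=
  shortExact_moduleCatMk (hK.lTensor_injective hΩ hF hf) (lTensor_exact Ω hfg hg)
    (LinearMap.lTensor_surjective Ω hg)

lemma IsTensorAcyclic.of_shortExact [IsNoetherianRing R] (hΩ : IsDualizingModule Ω)
    [Module.Finite R K] (hK : IsTensorAcyclic Ω K) (hF : IsTensorAcyclic Ω F) {f : K →ₗ[R] F}
    {g : F →ₗ[R] M} (hf : Function.Injective f) (hfg : Function.Exact f g)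
    (hg : Function.Surjective g) : IsTensorAcyclic Ω M := by
  have hS := hK.shortExact_lTensor hΩ hF hf hfg hg
  have hinj := hK.lTensor_injective hΩ hF hf
  refine ⟨⟨?_, fun h ↦ ?_⟩, fun i hi ↦ ?_, ?_⟩
  · refine (injective_iff_map_eq_zero _).2 fun m hm ↦ ?_
    obtain ⟨b, rfl⟩ := hg m
    have hb (t : Ω) : t ⊗ₜ[R] b ∈ LinearMap.range (f.lTensor Ω) := by
      refine (lTensor_exact Ω hfg hg _).1 ?_
      simpa using congrArg (fun l : Ω →ₗ[R] Ω ⊗[R] M ↦ l t) hm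
    -- The map `t ↦ t ⊗ b` lands in the image of `Ω ⊗ K`, so it lifts to a map `Ω → Ω ⊗ K`, which
    -- comes from some `k`; then `f k = b` dies in `M`.
    obtain ⟨k, hk⟩ := hK.bijective.2 ((LinearEquiv.ofInjective _ hinj).symm.toLinearMap ∘ₗ
      ((TensorProduct.mk R Ω F).flip b).codRestrict (LinearMap.range (f.lTensor Ω)) hb)
    have hkb : f k = b := by
      refine hF.bijective.1 ?_
      ext t
      have h1 : t ⊗ₜ[R] k = (LinearEquiv.ofInjective _ hinj).symm ⟨t ⊗ₜ[R] b, hb t⟩ :=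
        congrArg (fun l : Ω →ₗ[R] Ω ⊗[R] K ↦ l t) hk
      have h2 := congrArg (f.lTensor Ω) h1
      rw [← LinearEquiv.ofInjective_apply (f.lTensor Ω) (h := hinj),
        ← LinearEquiv.ofInjective_apply (f.lTensor Ω) (h := hinj),
        LinearEquiv.apply_symm_apply] at h2
      simpa using h2
    rw [← hkb]
    exact hfg.apply_apply_eq_zero k
  · obtain ⟨h', hh'⟩ := exists_lift_of_subsingleton_ext hS (X := Ω) (hK.ext_eq_zero 1 one_pos)
      (ModuleCat.ofHom h)
    obtain ⟨b, hb⟩ := hF.bijective.2 h'.hom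
    refine ⟨g b, ?_⟩
    ext t
    have h1 : t ⊗ₜ[R] b = h'.hom t := congrArg (fun l : Ω →ₗ[R] Ω ⊗[R] F ↦ l t) hb
    have h2 : g.lTensor Ω (h'.hom t) = h t := congrArg (fun l ↦ l.hom t) hh'
    rw [← h2, ← h1]
    simp
  · exact subsingleton_ext_X₃ hS Ω (hF.ext_eq_zero i hi) (hK.ext_eq_zero (i + 1) i.succ_pos)
  · obtain ⟨a, ha⟩ := hK.exists_injectiveDimension
    obtain ⟨b, hb⟩ := hF.exists_injectiveDimension
    exact ⟨a + b, hS.hasInjectiveDimensionLT_X₃ (a + b)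
      (hasInjectiveDimensionLT_of_ge (ModuleCat.of R _) b _ (by lia))
      (hasInjectiveDimensionLT_of_ge (ModuleCat.of R _) a _ (by lia))⟩

lemma subsingleton_ext_of_subsingleton (X : ModuleCat.{u} R) [Subsingleton M] (i : ℕ) :
    Subsingleton (Ext.{u} X (ModuleCat.of R M) i) := by
  have := (ModuleCat.isZero_of_subsingleton (ModuleCat.of R M)).hasInjectiveDimensionLT_zero
  exact HasInjectiveDimensionLT.subsingleton _ 0 i i.zero_le X

lemma isTensorAcyclic_of_subsingleton [Subsingleton M] : IsTensorAcyclic Ω M := by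
  have h : Subsingleton (Ω ⊗[R] M) := inferInstance
  exact ⟨⟨Function.injective_of_subsingleton _, fun _ ↦ ⟨0, Subsingleton.elim _ _⟩⟩,
    fun i _ ↦ subsingleton_ext_of_subsingleton Ω i,
    0, (ModuleCat.isZero_of_subsingleton _).hasInjectiveDimensionLT_zero⟩

lemma IsTensorAcyclic.of_equiv [IsNoetherianRing R] (hΩ : IsDualizingModule Ω)
    (hF : IsTensorAcyclic Ω F) (e : F ≃ₗ[R] M) : IsTensorAcyclic Ω M :=
  (isTensorAcyclic_of_subsingleton (M := PUnit.{u + 1})).of_shortExact hΩ hF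
    (f := 0) (g := e.toLinearMap) (Function.injective_of_subsingleton _)
    (by rw [LinearMap.exact_zero_iff_injective]; exact e.injective) e.surjective

lemma IsTensorAcyclic.prod (hK : IsTensorAcyclic Ω K) (hM : IsTensorAcyclic Ω M) :
    IsTensorAcyclic Ω (K × M) := by
  have hdec (x : Ω ⊗[R] (K × M)) : (LinearMap.inl R K M).lTensor Ω
      ((LinearMap.fst R K M).lTensor Ω x) + (LinearMap.inr R K M).lTensor Ω
      ((LinearMap.snd R K M).lTensor Ω x) = x := by
    induction x using TensorProduct.induction_on with
    | zero => simp
    | tmul a b => simp [← TensorProduct.tmul_add]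
    | add a b ha hb =>
      nth_rewrite 3 [← ha]
      nth_rewrite 3 [← hb]
      simp only [map_add]
      abel
  have hS : (ShortComplex.moduleCatMk ((LinearMap.inl R K M).lTensor Ω)
      ((LinearMap.snd R K M).lTensor Ω) (lTensor_exact Ω Function.Exact.inl_snd
        LinearMap.snd_surjective).linearMap_comp_eq_zero).ShortExact := by
    refine shortExact_moduleCatMk (Function.LeftInverse.injective
      (g := (LinearMap.fst R K M).lTensor Ω) fun x ↦ ?_)
      (lTensor_exact Ω Function.Exact.inl_snd LinearMap.snd_surjective)
      (LinearMap.lTensor_surjective Ω LinearMap.snd_surjective)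
    rw [← LinearMap.comp_apply, ← LinearMap.lTensor_comp, LinearMap.fst_comp_inl,
      LinearMap.lTensor_id, LinearMap.id_apply]
  refine ⟨⟨?_, fun h ↦ ?_⟩, fun i hi ↦ ?_, ?_⟩
  · refine (injective_iff_map_eq_zero _).2 fun m hm ↦ ?_
    have hm' (t : Ω) : t ⊗ₜ[R] m = 0 := congrArg (fun l : Ω →ₗ[R] Ω ⊗[R] (K × M) ↦ l t) hm
    refine Prod.ext (hK.bijective.1 ?_) (hM.bijective.1 ?_) <;> ext t
    · simpa using congrArg ((LinearMap.fst R K M).lTensor Ω) (hm' t)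
    · simpa using congrArg ((LinearMap.snd R K M).lTensor Ω) (hm' t)
  · obtain ⟨k, hk⟩ := hK.bijective.2 ((LinearMap.fst R K M).lTensor Ω ∘ₗ h)
    obtain ⟨m, hm⟩ := hM.bijective.2 ((LinearMap.snd R K M).lTensor Ω ∘ₗ h)
    refine ⟨(k, m), ?_⟩
    ext t
    have h1 : t ⊗ₜ[R] k = (LinearMap.fst R K M).lTensor Ω (h t) :=
      congrArg (fun l : Ω →ₗ[R] Ω ⊗[R] K ↦ l t) hk
    have h2 : t ⊗ₜ[R] m = (LinearMap.snd R K M).lTensor Ω (h t) :=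
      congrArg (fun l : Ω →ₗ[R] Ω ⊗[R] M ↦ l t) hm
    rw [← hdec (h t), ← h1, ← h2]
    simp [← TensorProduct.tmul_add]
  · exact subsingleton_ext_X₂ hS Ω (hK.ext_eq_zero i hi) (hM.ext_eq_zero i hi)
  · obtain ⟨a, ha⟩ := hK.exists_injectiveDimension
    obtain ⟨b, hb⟩ := hM.exists_injectiveDimension
    exact ⟨a + b, hS.hasInjectiveDimensionLT_X₂ (a + b)
      (hasInjectiveDimensionLT_of_ge (ModuleCat.of R _) a _ (by lia))
      (hasInjectiveDimensionLT_of_ge (ModuleCat.of R _) b _ (by lia))⟩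

lemma IsDualizingModule.isTensorAcyclic_self (hΩ : IsDualizingModule Ω) :
    IsTensorAcyclic Ω R := by
  have e : Ω ≅ ModuleCat.of R (Ω ⊗[R] R) := (TensorProduct.rid R Ω).symm.toModuleIso
  refine ⟨?_, fun i hi ↦ subsingleton_ext_of_iso (Iso.refl _) e (hΩ.ext_eq_zero i hi), ?_⟩
  · have : ⇑(TensorProduct.mk R Ω R).flip = (fun h : Ω →ₗ[R] Ω ↦
        (TensorProduct.rid R Ω).symm.toLinearMap ∘ₗ h) ∘
        fun r : R ↦ (r • LinearMap.id : Ω →ₗ[R] Ω) := by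
      ext r t
      change t ⊗ₜ[R] r = (r • t) ⊗ₜ[R] 1
      rw [TensorProduct.smul_tmul, smul_eq_mul, mul_one]
    rw [this]
    refine Function.Bijective.comp ⟨fun a b hab ↦ ?_, fun b ↦
      ⟨(TensorProduct.rid R Ω).toLinearMap ∘ₗ b, ?_⟩⟩ hΩ.homothety_bijective
    · ext t
      exact (TensorProduct.rid R Ω).symm.injective
        (congrArg (fun l : Ω →ₗ[R] Ω ⊗[R] R ↦ l t) hab)
    · ext t
      exact (TensorProduct.rid R Ω).symm_apply_apply _
  · obtain ⟨n, hn⟩ := (injectiveDimension_ne_top_iff _).1 hΩ.injectiveDimension_ne_top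
    exact ⟨n + 1, hasInjectiveDimensionLT_of_iso e (n + 1)⟩

lemma IsDualizingModule.isTensorAcyclic_pi [IsNoetherianRing R] (hΩ : IsDualizingModule Ω)
    (n : ℕ) : IsTensorAcyclic Ω (Fin n → R) := by
  induction n with
  | zero => exact isTensorAcyclic_of_subsingleton
  | succ n ih =>
    exact (hΩ.isTensorAcyclic_self.prod ih).of_equiv hΩ (Fin.consLinearEquiv R fun _ ↦ R)

lemma IsDualizingModule.isTensorAcyclic_of_projective [IsNoetherianRing R] [IsLocalRing R]
    (hΩ : IsDualizingModule Ω) [Module.Finite R M] [Module.Projective R M] :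
    IsTensorAcyclic Ω M := by
  have : Module.Free R M := Module.free_of_flat_of_isLocalRing
  exact (hΩ.isTensorAcyclic_pi _).of_equiv hΩ (Module.finBasis R M).equivFun.symm

lemma IsDualizingModule.isTensorAcyclic_of_hasProjectiveDimensionLT [IsNoetherianRing R]
    [IsLocalRing R] (hΩ : IsDualizingModule Ω) [Module.Finite R M] {n : ℕ}
    (h : HasProjectiveDimensionLT (ModuleCat.of R M) (n + 1)) : IsTensorAcyclic Ω M := by
  induction n generalizing M with
  | zero =>
    have : Projective (ModuleCat.of R M) := projective_iff_hasProjectiveDimensionLT_one.2 h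
    have : Module.Projective R M := (IsProjective.iff_projective M).2 this
    exact hΩ.isTensorAcyclic_of_projective
  | succ n ih =>
    obtain ⟨m, g, hg⟩ := Module.Finite.exists_fin' R M
    have hS := shortExact_moduleCatMk (LinearMap.ker g).injective_subtype
      (LinearMap.exact_subtype_ker_map g) hg
    have hP : HasProjectiveDimensionLT (ModuleCat.of R (Fin m → R)) (n + 1) := by
      have : Projective (ModuleCat.of R (Fin m → R)) :=
        (IsProjective.iff_projective (Fin m → R)).1 inferInstance
      have := projective_iff_hasProjectiveDimensionLT_one.1 this
      exact hasProjectiveDimensionLT_of_ge _ 1 _ (by lia)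
    have hK : HasProjectiveDimensionLT (ModuleCat.of R (LinearMap.ker g)) (n + 1) :=
      hS.hasProjectiveDimensionLT_X₁ (n + 1) hP h
    exact (ih hK).of_shortExact hΩ (hΩ.isTensorAcyclic_pi m)
      (LinearMap.ker g).injective_subtype (LinearMap.exact_subtype_ker_map g) hg

end TensorAcyclic

/-! ### Vanishing of `Ext(Ω, -)` on modules of finite injective dimension -/

section ExtVanishingFiniteInjectiveDimension

open Abelian TensorProduct

variable {R : Type u} [CommRing R] [IsLocalRing R]

variable (Ω : ModuleCat.{u} R)

/-- The properties of `R / (x₁, …, xᵢ)`, for a regular sequence `x₁, …, xᵢ`, that are used to bound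
`Ext(Ω, -)`. -/
structure IsRegularQuotient (i : ℕ) (M : Type u) [AddCommGroup M] [Module R M] : Prop where
  finite : Module.Finite R M
  nontrivial : Nontrivial M
  isTensorAcyclic : IsTensorAcyclic Ω M
  hasProjectiveDimensionLT : HasProjectiveDimensionLT (ModuleCat.of R M) (i + 1)
  descend : ∀ (Y : ModuleCat.{u} R) [Module.Finite R Y],
    (∀ j, i < j → Subsingleton (Ext.{u} (ModuleCat.of R (Ω ⊗[R] M)) Y j)) →
    ∀ j, 0 < j → Subsingleton (Ext.{u} Ω Y j)

variable {Ω}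

lemma IsDualizingModule.isRegularQuotient_self (hΩ : IsDualizingModule Ω) :
    IsRegularQuotient Ω 0 R where
  finite := inferInstance
  nontrivial := inferInstance
  isTensorAcyclic := hΩ.isTensorAcyclic_self
  hasProjectiveDimensionLT := by
    have : Projective (ModuleCat.of R R) := (IsProjective.iff_projective R).1 inferInstance
    exact projective_iff_hasProjectiveDimensionLT_one.1 this
  descend Y _ h j hj := subsingleton_ext_of_iso (TensorProduct.rid R Ω).toModuleIso (Iso.refl Y)
    (h j hj)

variable [IsNoetherianRing R]

lemma subsingleton_ext_of_isSMulRegular {X C : Type u} [AddCommGroup X] [Module R X]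
    [AddCommGroup C] [Module R C] [Module.Finite R X] {Y : ModuleCat.{u} R} [Module.Finite R Y]
    {x : R} (hx : x ∈ IsLocalRing.maximalIdeal R) (hreg : IsSMulRegular X x) {p : X →ₗ[R] C}
    (hp : Function.Exact (LinearMap.lsmul R X x) p) (hsurj : Function.Surjective p) {n : ℕ}
    (h : Subsingleton (Ext.{u} (ModuleCat.of R C) Y (n + 1))) :
    Subsingleton (Ext.{u} (ModuleCat.of R X) Y n) :=
  subsingleton_ext_of_subsingleton_ext_cokernel_smul (X := ModuleCat.of R X)
    (C := ModuleCat.of R C) hx (ModuleCat.ofHom p) _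
    (shortExact_moduleCatMk (f := LinearMap.lsmul R X x) hreg hp hsurj) h

/-- If `Ext^{n+1}(X, Y) = 0` for all finitely generated `X`, then the vanishing of
`Ext^n(k, Y)` implies that of `Ext^n(X, Y)` for all finitely generated `X`. -/
lemma subsingleton_ext_of_residueField {Y : ModuleCat.{u} R} [Module.Finite R Y] {n : ℕ}
    (h : ∀ (X : Type u) [AddCommGroup X] [Module R X] [Module.Finite R X],
      Subsingleton (Ext.{u} (ModuleCat.of R X) Y (n + 1)))
    (hk : Subsingleton (Ext.{u} (ModuleCat.of R (R ⧸ IsLocalRing.maximalIdeal R)) Y n))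
    (X : Type u) [AddCommGroup X] [Module R X] [Module.Finite R X] :
    Subsingleton (Ext.{u} (ModuleCat.of R X) Y n) := by
  refine IsNoetherianRing.induction_on_isQuotientEquivQuotientPrime R (M := X) inferInstance
    (motive := fun X _ _ _ ↦ Subsingleton (Ext.{u} (ModuleCat.of R X) Y n))
    (fun X _ _ _ _ ↦ ?_) (fun X _ _ _ p e ↦ ?_)
    (fun N₁ _ _ _ N₂ _ _ _ N₃ _ _ _ f g hf hg hfg h₁ h₃ ↦ ?_)
  · have := (ModuleCat.isZero_of_subsingleton (ModuleCat.of R X)).hasProjectiveDimensionLT_zero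
    exact HasProjectiveDimensionLT.subsingleton _ 0 n n.zero_le Y
  · by_cases hp : p.1 = IsLocalRing.maximalIdeal R
    · rw [hp] at e
      exact subsingleton_ext_of_iso e.symm.toModuleIso (Iso.refl Y) hk
    · obtain ⟨x, hx, hxp⟩ := SetLike.exists_of_lt
        (lt_of_le_of_ne (IsLocalRing.le_maximalIdeal p.2.ne_top) hp)
      have hreg : IsSMulRegular X x := by
        refine isSMulRegular_iff_right_eq_zero_of_smul.2 fun a ha ↦ ?_
        obtain ⟨r, hr⟩ := Ideal.Quotient.mk_surjective (I := p.1) (e a)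
        have h1 : x • e a = 0 := by rw [← map_smul, ha, map_zero]
        have h2 : Ideal.Quotient.mk p.1 (x * r) = 0 := by
          rw [map_mul, hr]
          exact h1
        have h3 : r ∈ p.1 :=
          (p.2.mem_or_mem (Ideal.Quotient.eq_zero_iff_mem.1 h2)).resolve_left hxp
        rw [← Ideal.Quotient.eq_zero_iff_mem, hr] at h3
        simpa using h3
      exact subsingleton_ext_of_isSMulRegular hx hreg (LinearMap.exact_lsmul_mkQ_smul_top X x)
        (Submodule.mkQ_surjective _) (h _)
  · exact subsingleton_ext_X₂_left (shortExact_moduleCatMk hf hfg hg) Y h₁ h₃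

/-- A module `M` containing the residue field and with `Ext^j(M, -) = 0` for `j > i` bounds the
injective dimension of finitely generated modules `Y` of finite injective dimension, in the sense
that `Ext^j(-, Y)` vanishes on finitely generated modules for `j > i`. -/
lemma subsingleton_ext_of_embedding_residueField {Y M : ModuleCat.{u} R} [Module.Finite R Y]
    [Module.Finite R M] {n i : ℕ} (hY : HasInjectiveDimensionLT Y n)
    (hM : HasProjectiveDimensionLT M (i + 1)) {f : R ⧸ IsLocalRing.maximalIdeal R →ₗ[R] M}
    (hf : Function.Injective f) {j : ℕ} (hj : i < j) (X : Type u) [AddCommGroup X] [Module R X]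
    [Module.Finite R X] : Subsingleton (Ext.{u} (ModuleCat.of R X) Y j) := by
  -- Descending induction on `j`, starting from the given bound `n`. Below it, `Ext^j(k, Y)` is
  -- caught between `Ext^j(M, Y)`, zero because `pd M ≤ i < j`, and `Ext^{j+1}` of the cokernel of
  -- `f`.
  rcases le_or_gt n j with hnj | hnj
  · exact HasInjectiveDimensionLT.subsingleton Y n j hnj _
  · have key := fun (X : Type u) [AddCommGroup X] [Module R X] [Module.Finite R X] ↦
      subsingleton_ext_of_embedding_residueField hY hM hf (j := j + 1) (by lia) X
    refine subsingleton_ext_of_residueField key ?_ X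
    exact subsingleton_ext_X₁_left (shortExact_moduleCatMk hf (LinearMap.exact_map_mkQ_range f)
      (Submodule.mkQ_surjective _)) Y (HasProjectiveDimensionLT.subsingleton M (i + 1) j hj Y)
      (key _)
termination_by n - j

/-- Tensoring multiplication by `x` with `Ω` keeps it injective, so `x` is regular on `Ω ⊗ M` too.
Each further element thus costs one degree, both in the projective dimension and in the Nakayama
descent of Ext vanishing. -/
lemma IsRegularQuotient.quotSMulTop (hΩ : IsDualizingModule Ω) {i : ℕ} {M : Type u}
    [AddCommGroup M] [Module R M] (hM : IsRegularQuotient Ω i M) {x : R}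
    (hx : x ∈ IsLocalRing.maximalIdeal R) (hreg : IsSMulRegular M x) :
    IsRegularQuotient Ω (i + 1) (QuotSMulTop x M) := by
  have := hM.finite
  have := hM.nontrivial
  have := hΩ.finite
  have hS := shortExact_moduleCatMk (f := LinearMap.lsmul R M x) hreg
    (LinearMap.exact_lsmul_mkQ_smul_top M x) (Submodule.mkQ_surjective _)
  have hT : (LinearMap.lsmul R M x).lTensor Ω = LinearMap.lsmul R (Ω ⊗[R] M) x := by
    ext t m
    simp
  refine ⟨inferInstance, ?_, hM.isTensorAcyclic.of_shortExact hΩ hM.isTensorAcyclic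
    (f := LinearMap.lsmul R M x) hreg (LinearMap.exact_lsmul_mkQ_smul_top M x)
      (Submodule.mkQ_surjective _),
    hS.hasProjectiveDimensionLT_X₃ (i + 1) hM.hasProjectiveDimensionLT
      (by
        have := hM.hasProjectiveDimensionLT
        exact hasProjectiveDimensionLT_of_ge (ModuleCat.of R M) (i + 1) _ (by lia)),
    fun Y _ h ↦ hM.descend Y fun j hj ↦ ?_⟩
  · exact nontrivial_quotSMulTop_of_mem_maximalIdeal M hx
  · have hreg' : IsSMulRegular (Ω ⊗[R] M) x := by
      have := hM.isTensorAcyclic.lTensor_injective hΩ hM.isTensorAcyclic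
        (f := LinearMap.lsmul R M x) hreg
      rw [hT] at this
      exact this
    refine subsingleton_ext_of_isSMulRegular hx hreg' ?_
      (LinearMap.lTensor_surjective Ω (Submodule.mkQ_surjective _)) (h (j + 1) (by lia))
    rw [← hT]
    exact lTensor_exact Ω (LinearMap.exact_lsmul_mkQ_smul_top M x) (Submodule.mkQ_surjective _)

/-- If `Hom(k, M) = 0`, the maximal ideal contains an `M`-regular `x`. Passing to `M/xM` strictly
enlarges the annihilator, which now contains `x`, so the process stops; a nonzero map from the
simple module `k` is then injective. -/
lemma IsRegularQuotient.exists_embedding_residueField (hΩ : IsDualizingModule Ω) {i : ℕ}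
    {M : Type u} [AddCommGroup M] [Module R M] (hM : IsRegularQuotient Ω i M) :
    ∃ (j : ℕ) (M' : ModuleCat.{u} R) (f : R ⧸ IsLocalRing.maximalIdeal R →ₗ[R] M'),
      IsRegularQuotient Ω j M' ∧ Function.Injective f := by
  induction h : Module.annihilator R M using WellFoundedGT.induction generalizing i M with
  | ind I ih =>
  subst h
  have := hM.finite
  by_cases hsub : Subsingleton (R ⧸ IsLocalRing.maximalIdeal R →ₗ[R] M)
  · obtain ⟨x, hx, hreg⟩ := IsSMulRegular.subsingleton_linearMap_iff.1 hsub
    rw [Ideal.annihilator_quotient] at hx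
    have hM' := hM.quotSMulTop hΩ hx hreg
    refine ih _ (lt_of_le_of_ne ?_ fun heq ↦ ?_) hM' rfl
    · exact LinearMap.annihilator_le_of_surjective (Submodule.mkQ _) (Submodule.mkQ_surjective _)
    · have hxm : x ∈ Module.annihilator R M := by
        rw [heq]
        refine Module.mem_annihilator.2 fun q ↦ ?_
        obtain ⟨m, rfl⟩ := Submodule.mkQ_surjective _ q
        rw [← map_smul, Submodule.mkQ_apply, Submodule.Quotient.mk_eq_zero]
        exact Submodule.smul_mem_pointwise_smul m x ⊤ trivial
      obtain ⟨m, hm⟩ := @exists_ne M hM.nontrivial 0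
      exact hm (hreg (by simpa using Module.mem_annihilator.1 hxm m))
  · rw [not_subsingleton_iff_nontrivial] at hsub
    obtain ⟨f, hf⟩ := exists_ne (0 : R ⧸ IsLocalRing.maximalIdeal R →ₗ[R] M)
    have hsimple : IsSimpleModule R (R ⧸ IsLocalRing.maximalIdeal R) :=
      isSimpleModule_iff_isCoatom.2 (IsLocalRing.maximalIdeal.isMaximal R).out
    exact ⟨i, ModuleCat.of R M, f, hM, (LinearMap.injective_or_eq_zero f).resolve_right hf⟩

/-- `Ext^j(Ω, Y) = 0` for `j > 0` and `Y` finitely generated of finite injective dimension. -/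
lemma IsDualizingModule.subsingleton_ext (hΩ : IsDualizingModule Ω) {Y : ModuleCat.{u} R}
    [Module.Finite R Y] {n : ℕ} (hY : HasInjectiveDimensionLT Y n) {j : ℕ} (hj : 0 < j) :
    Subsingleton (Ext.{u} Ω Y j) := by
  obtain ⟨i, M, f, hM, hf⟩ := hΩ.isRegularQuotient_self.exists_embedding_residueField hΩ
  have := hM.finite
  have := hΩ.finite
  exact hM.descend Y (fun j hj ↦ subsingleton_ext_of_embedding_residueField hY
    hM.hasProjectiveDimensionLT hf hj _) j hj

end ExtVanishingFiniteInjectiveDimension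

/-! ### Hom evaluation into an injective module -/

section HomEvaluation

open TensorProduct

variable {R : Type u} [CommRing R] (X W I : Type u) [AddCommGroup X] [Module R X]
  [AddCommGroup W] [Module R W] [AddCommGroup I] [Module R I]

/-- The evaluation map `X ⊗ Hom(W, I) → Hom(Hom(X, W), I)`, `x ⊗ g ↦ (h ↦ g (h x))`. -/
noncomputable def homEvaluation : X ⊗[R] (W →ₗ[R] I) →ₗ[R] (X →ₗ[R] W) →ₗ[R] I :=
  TensorProduct.lift (LinearMap.mk₂ R (fun x g ↦ g ∘ₗ LinearMap.applyₗ x)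
    (fun x y g ↦ by ext; simp) (fun r x g ↦ by ext; simp) (fun x g g' ↦ by ext; simp)
    (fun r x g ↦ by ext; simp))

variable {X W I}

@[simp]
lemma homEvaluation_tmul_apply (x : X) (g : W →ₗ[R] I) (h : X →ₗ[R] W) :
    homEvaluation X W I (x ⊗ₜ g) h = g (h x) := rfl

lemma homEvaluation_rTensor {X' : Type u} [AddCommGroup X'] [Module R X'] (f : X →ₗ[R] X')
    (z : X ⊗[R] (W →ₗ[R] I)) :
    homEvaluation X' W I (f.rTensor _ z) = homEvaluation X W I z ∘ₗ LinearMap.lcomp R W f := by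
  induction z using TensorProduct.induction_on with
  | zero => simp
  | tmul x g => ext h; simp
  | add a b ha hb => rw [map_add, map_add, map_add, ha, hb, LinearMap.add_comp]

variable (W I) in
lemma homEvaluation_pi_bijective (n : ℕ) :
    Function.Bijective (homEvaluation (R := R) (Fin n → R) W I) := by
  -- The inverse restricts a functional on `Hom(R^n, W) ≅ W^n` to its `i`-th copy of `W` and pairs
  -- the result with the `i`-th basis vector.
  refine Function.bijective_iff_has_inverse.2 ⟨fun h ↦ ∑ i, Pi.single i 1 ⊗ₜ
    (h ∘ₗ LinearMap.smulRightₗ (M := W) (LinearMap.proj i : (Fin n → R) →ₗ[R] R)),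
    fun z ↦ ?_, fun h ↦ ?_⟩
  · induction z using TensorProduct.induction_on with
    | zero => simp
    | tmul x g =>
      have (i : Fin n) : homEvaluation (R := R) (Fin n → R) W I (x ⊗ₜ g) ∘ₗ
          LinearMap.smulRightₗ (M := W) (LinearMap.proj i : (Fin n → R) →ₗ[R] R) = x i • g := by
        ext w
        simp
      simp only [this, ← TensorProduct.smul_tmul, ← TensorProduct.sum_tmul]
      rw [← pi_eq_sum_univ' x]
    | add a b ha hb =>
      simp only [map_add, LinearMap.add_comp, TensorProduct.tmul_add, Finset.sum_add_distrib] at *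
      rw [ha, hb]
  · ext l
    simp only [map_sum, LinearMap.sum_apply, homEvaluation_tmul_apply, LinearMap.comp_apply]
    rw [← map_sum]
    congr 1
    ext i
    simp [Pi.single_apply]

/-- Both sides are right exact in `X` when `I` is injective, so a finite presentation `R^m → R^n →
X` reduces the claim to free modules. -/
lemma homEvaluation_bijective [IsNoetherianRing R] [Module.Finite R X]
    (hI : Module.Injective R I) : Function.Bijective (homEvaluation (R := R) X W I) := by
  obtain ⟨n, f, hf⟩ := Module.Finite.exists_fin' R X
  obtain ⟨m, g, hg⟩ := Module.Finite.exists_fin' R (LinearMap.ker f)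
  have hinj : Function.Injective (LinearMap.lcomp R W f) :=
    LinearMap.lcomp_injective_of_surjective f hf
  refine ⟨(injective_iff_map_eq_zero _).2 fun z hz ↦ ?_, fun h ↦ ?_⟩
  · obtain ⟨y, rfl⟩ := LinearMap.rTensor_surjective (W →ₗ[R] I) hf z
    rw [homEvaluation_rTensor] at hz
    set G := LinearMap.lcomp R W ((LinearMap.ker f).subtype ∘ₗ g) with hG
    have hex : Function.Exact ((LinearMap.ker f).subtype ∘ₗ g) f := by
      rw [LinearMap.exact_iff, LinearMap.range_comp, LinearMap.range_eq_top.2 hg,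
        Submodule.map_top, Submodule.range_subtype]
    have hker : LinearMap.ker G ≤ LinearMap.ker (homEvaluation (R := R) (Fin n → R) W I y) := by
      intro l hl
      obtain ⟨q, rfl⟩ := (LinearMap.exact_lcomp_of_exact_of_surjective W hex hf l).1 hl
      exact congrArg (fun t ↦ t q) hz
    -- Evaluation at `y` kills `ker G`, so it factors through `Hom(R^n, W) / ker G`, which embeds in
    -- `Hom(R^m, W)`; injectivity of `I` extends it there.
    obtain ⟨h, hh⟩ := hI.out ((LinearMap.ker G).liftQ G le_rfl)
      (LinearMap.ker_eq_bot.1 (Submodule.ker_liftQ_eq_bot' _ _ rfl))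
      ((LinearMap.ker G).liftQ (homEvaluation (R := R) (Fin n → R) W I y) hker)
    obtain ⟨y', rfl⟩ := (homEvaluation_pi_bijective W I m).2 h
    have hy : y = ((LinearMap.ker f).subtype ∘ₗ g).rTensor _ y' := by
      refine (homEvaluation_pi_bijective W I n).1 ?_
      rw [homEvaluation_rTensor]
      ext1 l
      exact (hh (Submodule.Quotient.mk l)).symm
    rw [hy, ← LinearMap.comp_apply, ← LinearMap.rTensor_comp, hex.linearMap_comp_eq_zero,
      LinearMap.rTensor_zero, LinearMap.zero_apply]
  · obtain ⟨h', hh'⟩ := Module.Injective.out (LinearMap.lcomp R W f) hinj h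
    obtain ⟨y, rfl⟩ := (homEvaluation_pi_bijective W I n).2 h'
    refine ⟨f.rTensor _ y, ?_⟩
    rw [homEvaluation_rTensor]
    ext l
    exact hh' l

end HomEvaluation

/-! ### Tor vanishing and projective dimension -/

section TorVanishing

open Abelian TensorProduct

variable (R : Type u) [CommRing R]

/-- `Tor₁(X, J) = 0` for a finitely generated module `X`, expressed through presentations
of `X`. -/
def TorOneVanishes (X J : Type u) [AddCommGroup X] [Module R X] [AddCommGroup J] [Module R J] :
    Prop :=
  ∀ (F : Type u) [AddCommGroup F] [Module R F] [Module.Finite R F] [Module.Free R F]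
    (f : F →ₗ[R] X), Function.Surjective f →
      Function.Injective ((LinearMap.ker f).subtype.rTensor J)

variable {R} {X A B C : Type u} [AddCommGroup X] [Module R X] [AddCommGroup A] [Module R A]
  [AddCommGroup B] [Module R B] [AddCommGroup C] [Module R C]

/-- A diagram chase on the sequence tensored with `0 → ker f → F → X → 0`, where the row at `F` is
exact by flatness and `ker f ⊗ C → F ⊗ C` is injective by hypothesis. -/
lemma TorOneVanishes.lTensor_injective [Module.Finite R X] (hC : TorOneVanishes R X C)
    {i : A →ₗ[R] B} {p : B →ₗ[R] C} (hi : Function.Injective i) (hip : Function.Exact i p)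
    (hp : Function.Surjective p) : Function.Injective (i.lTensor X) := by
  obtain ⟨n, f, hf⟩ := Module.Finite.exists_fin' R X
  set s := (LinearMap.ker f).subtype
  have hs (J : Type u) [AddCommGroup J] [Module R J] :
      Function.Exact (s.rTensor J) (f.rTensor J) :=
    rTensor_exact J (LinearMap.exact_subtype_ker_map f) hf
  have comm {X X' J J' : Type u} [AddCommGroup X] [Module R X] [AddCommGroup X'] [Module R X']
      [AddCommGroup J] [Module R J] [AddCommGroup J'] [Module R J'] (a : X →ₗ[R] X')
      (b : J →ₗ[R] J') (z : X ⊗[R] J) :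
      a.rTensor J' (b.lTensor X z) = b.lTensor X' (a.rTensor J z) := by
    rw [← LinearMap.comp_apply, ← LinearMap.comp_apply, LinearMap.rTensor_comp_lTensor,
      LinearMap.lTensor_comp_rTensor]
  refine (injective_iff_map_eq_zero _).2 fun z hz ↦ ?_
  obtain ⟨w, rfl⟩ := LinearMap.rTensor_surjective A hf z
  rw [← comm] at hz
  obtain ⟨v, hv⟩ := (hs B _).1 hz
  have hv0 : p.lTensor _ v = 0 := by
    refine hC (Fin n → R) f hf ?_
    rw [map_zero, comm, hv, ← LinearMap.comp_apply, ← LinearMap.lTensor_comp,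
      hip.linearMap_comp_eq_zero, LinearMap.lTensor_zero, LinearMap.zero_apply]
  obtain ⟨t, rfl⟩ := (lTensor_exact _ hip hp _).1 hv0
  have hw : s.rTensor A t = w := by
    refine Module.Flat.lTensor_preserves_injective_linearMap (M := Fin n → R) i hi ?_
    rw [← hv, comm]
  rw [← hw]
  exact (hs A).apply_apply_eq_zero t

/-- Dimension shifting: `Tor₁(X, A)` lies between `Tor₂(X, C)` and `Tor₁(X, B)`. -/
lemma TorOneVanishes.of_shortExact [IsNoetherianRing R]
    (hC : ∀ (F : Type u) [AddCommGroup F] [Module R F] [Module.Finite R F] [Module.Free R F]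
      (f : F →ₗ[R] X), Function.Surjective f → TorOneVanishes R (LinearMap.ker f) C)
    (hB : TorOneVanishes R X B) {i : A →ₗ[R] B} {p : B →ₗ[R] C} (hi : Function.Injective i)
    (hip : Function.Exact i p) (hp : Function.Surjective p) : TorOneVanishes R X A := by
  intro F _ _ _ _ f hf
  -- `ker f ⊗ A → ker f ⊗ B → F ⊗ B` is injective and also factors through `F ⊗ A`.
  have h1 := (hB F f hf).comp ((hC F f hf).lTensor_injective hi hip hp)
  rw [← LinearMap.coe_comp, LinearMap.rTensor_comp_lTensor, ← LinearMap.lTensor_comp_rTensor,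
    LinearMap.coe_comp] at h1
  exact h1.of_comp

lemma torOneVanishes_of_flat [Module.Flat R B] : TorOneVanishes R X B := fun _ _ _ _ _ f _ ↦
  Module.Flat.rTensor_preserves_injective_linearMap _ (LinearMap.ker f).injective_subtype

/-- `Tor₁(X, Hom(Ω, I)) = 0` if `Ext¹(X, Ω) = 0` and `I` is injective. -/
lemma torOneVanishes_hom [IsNoetherianRing R] {Ω : ModuleCat.{u} R} {I : Type u} [AddCommGroup I]
    [Module R I] (hI : Module.Injective R I)
    (hX : Subsingleton (Ext.{u} (ModuleCat.of R X) Ω 1)) :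
    TorOneVanishes R X (Ω →ₗ[R] I) := by
  intro F _ _ _ _ f hf
  refine (injective_iff_map_eq_zero _).2 fun z hz ↦ ?_
  refine (homEvaluation_bijective hI).1 ?_
  rw [map_zero]
  ext l
  obtain ⟨l', hl'⟩ := exists_extension_of_subsingleton_ext (shortExact_moduleCatMk
    (LinearMap.ker f).injective_subtype (LinearMap.exact_subtype_ker_map f) hf) hX
    (ModuleCat.ofHom l)
  have h1 := congrArg (homEvaluation _ Ω I) hz
  rw [homEvaluation_rTensor, map_zero] at h1
  have h2 : LinearMap.lcomp R Ω (LinearMap.ker f).subtype l'.hom = l :=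
    congrArg ModuleCat.Hom.hom hl'
  rw [← h2]
  exact congrArg (fun q ↦ q l'.hom) h1

/-- `Tor₁(X, J) = 0` for all finitely generated modules `X` with `Ext^i(X, Ω) = 0` for `i > j`. -/
def TorVanishes (Ω : ModuleCat.{u} R) (j : ℕ) (J : Type u) [AddCommGroup J] [Module R J] : Prop :=
  ∀ (X : Type u) [AddCommGroup X] [Module R X] [Module.Finite R X],
    (∀ i, j < i → Subsingleton (Ext.{u} (ModuleCat.of R X) Ω i)) → TorOneVanishes R X J

variable {Ω : ModuleCat.{u} R}

lemma subsingleton_ext_ker {F : Type u} [AddCommGroup F] [Module R F] [Module.Free R F]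
    {f : F →ₗ[R] X} (hf : Function.Surjective f) {i : ℕ} (hi : 0 < i)
    (h : Subsingleton (Ext.{u} (ModuleCat.of R X) Ω (i + 1))) :
    Subsingleton (Ext.{u} (ModuleCat.of R (LinearMap.ker f)) Ω i) := by
  have : Projective (ModuleCat.of R F) := (IsProjective.iff_projective F).1 inferInstance
  exact subsingleton_ext_X₁_left (shortExact_moduleCatMk (LinearMap.ker f).injective_subtype
    (LinearMap.exact_subtype_ker_map f) hf) Ω
    (HasProjectiveDimensionLT.subsingleton (ModuleCat.of R F) 1 i hi Ω) h

lemma TorVanishes.of_shortExact [IsNoetherianRing R] (hC : TorVanishes Ω 0 C)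
    (hB : TorVanishes Ω 0 B) {i : A →ₗ[R] B} {p : B →ₗ[R] C} (hi : Function.Injective i)
    (hip : Function.Exact i p) (hp : Function.Surjective p) : TorVanishes Ω 0 A :=
  fun X _ _ _ hX ↦ TorOneVanishes.of_shortExact
    (fun _ _ _ _ _ _ hf ↦ hC _ fun j hj ↦ subsingleton_ext_ker hf hj (hX (j + 1) (by lia)))
    (hB X hX) hi hip hp

/-- With `B` flat, `Tor₁(X, A)` is `Tor₂(X, C)`, that is, `Tor₁` of a syzygy of `X` with `C`; the
syzygy lowers the Ext bound on `X` by one. -/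
lemma TorVanishes.of_shortExact_of_flat [IsNoetherianRing R] {j : ℕ} (hC : TorVanishes Ω j C)
    [Module.Flat R B] {i : A →ₗ[R] B} {p : B →ₗ[R] C} (hi : Function.Injective i)
    (hip : Function.Exact i p) (hp : Function.Surjective p) : TorVanishes Ω (j + 1) A :=
  fun _ _ _ _ hX ↦ TorOneVanishes.of_shortExact
    (fun _ _ _ _ _ _ hf ↦ hC _ fun k hk ↦ subsingleton_ext_ker hf (by lia) (hX (k + 1) (by lia)))
    torOneVanishes_of_flat hi hip hp

/-- Each syzygy of `A` raises `j` by one. Once `j` reaches the injective dimension of `Ω`, the Ext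
condition holds for every `X`; then `Tor₁(R/I, A) = 0` for all ideals `I`, and `A` is flat, hence
projective. -/
lemma TorVanishes.hasProjectiveDimensionLT [IsNoetherianRing R] {j k : ℕ}
    (hΩ : HasInjectiveDimensionLT Ω (j + k + 1)) [Module.Finite R A] (hA : TorVanishes Ω j A) :
    HasProjectiveDimensionLT (ModuleCat.of R A) (k + 1) := by
  induction k generalizing j A with
  | zero =>
    have : Module.Flat R A := by
      rw [Module.Flat.iff_rTensor_injective']
      intro I
      have hI := hA (R ⧸ I) (fun i hi ↦
        HasInjectiveDimensionLT.subsingleton Ω (j + 0 + 1) i (by lia) _) R (Submodule.mkQ I)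
        (Submodule.mkQ_surjective I)
      rwa [Submodule.ker_mkQ] at hI
    have := Module.finitePresentation_of_finite R A
    have : Module.Projective R A := Module.Flat.projective_of_finitePresentation
    have : Module.Projective R A := inferInstance
    have : Projective (ModuleCat.of R A) := (IsProjective.iff_projective A).1 inferInstance
    exact projective_iff_hasProjectiveDimensionLT_one.1 this
  | succ k ih =>
    obtain ⟨m, g, hg⟩ := Module.Finite.exists_fin' R A
    have hS := shortExact_moduleCatMk (LinearMap.ker g).injective_subtype
      (LinearMap.exact_subtype_ker_map g) hg
    have hP : HasProjectiveDimensionLT (ModuleCat.of R (Fin m → R)) (k + 1 + 1) := by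
      have : Projective (ModuleCat.of R (Fin m → R)) :=
        (IsProjective.iff_projective (Fin m → R)).1 inferInstance
      have := projective_iff_hasProjectiveDimensionLT_one.1 this
      exact hasProjectiveDimensionLT_of_ge _ 1 _ (by lia)
    have hj : j + (k + 1) + 1 = j + 1 + k + 1 := by lia
    rw [hj] at hΩ
    exact hS.hasProjectiveDimensionLT_X₃ (k + 1) (ih hΩ (hA.of_shortExact_of_flat
      (LinearMap.ker g).injective_subtype (LinearMap.exact_subtype_ker_map g) hg)) hP

end TorVanishing

/-! ### The counit, by induction on injective dimension -/

section Counit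

open Abelian TensorProduct

variable {R : Type u} [CommRing R] {Ω : ModuleCat.{u} R}

variable (Ω) in
/-- The evaluation map `Ω ⊗ Hom(Ω, N) → N`, `t ⊗ β ↦ β t`. -/
noncomputable def evaluation (N : Type u) [AddCommGroup N] [Module R N] :
    Ω ⊗[R] (Ω →ₗ[R] N) →ₗ[R] N :=
  TensorProduct.lift (LinearMap.id.flip : Ω →ₗ[R] (Ω →ₗ[R] N) →ₗ[R] N)

lemma evaluation_lTensor {N N' : Type u} [AddCommGroup N] [Module R N] [AddCommGroup N']
    [Module R N'] (g : N →ₗ[R] N') (z : Ω ⊗[R] (Ω →ₗ[R] N)) :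
    evaluation Ω N' ((LinearMap.compRight R g).lTensor Ω z) = g (evaluation Ω N z) := by
  induction z using TensorProduct.induction_on with
  | zero => simp
  | tmul x g => rfl
  | add a b ha hb => simp only [map_add, ha, hb]

variable [IsNoetherianRing R]

lemma torVanishes_hom_of_injective {I : Type u} [AddCommGroup I] [Module R I]
    (hI : Module.Injective R I) : TorVanishes Ω 0 (Ω →ₗ[R] I) :=
  fun _ _ _ _ hX ↦ torOneVanishes_hom hI (hX 1 one_pos)

/-- Evaluation factors as `homEvaluation` with `X = W = Ω` followed by evaluation at the identity,
which is bijective because `Hom(Ω, Ω)` is free on the identity. -/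
lemma IsDualizingModule.evaluation_bijective_of_injective (hΩ : IsDualizingModule Ω) {I : Type u}
    [AddCommGroup I] [Module R I] (hI : Module.Injective R I) :
    Function.Bijective (evaluation Ω I) := by
  have := hΩ.finite
  have hb : Function.Bijective (LinearMap.toSpanSingleton R (Ω →ₗ[R] Ω) LinearMap.id) :=
    hΩ.homothety_bijective
  let e : (Ω →ₗ[R] Ω) ≃ₗ[R] R := (LinearEquiv.ofBijective _ hb).symm
  have h : ⇑(evaluation Ω I) = (fun l : (Ω →ₗ[R] Ω) →ₗ[R] I ↦ l LinearMap.id) ∘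
      homEvaluation Ω Ω I := by
    ext z
    induction z using TensorProduct.induction_on with
    | zero => simp
    | tmul x g => rfl
    | add a b ha hb =>
      simp only [Function.comp_apply, map_add, LinearMap.add_apply] at *
      rw [ha, hb]
  rw [h]
  refine Function.Bijective.comp ⟨fun l l' hl ↦ ?_, fun y ↦
    ⟨LinearMap.toSpanSingleton R I y ∘ₗ e.toLinearMap, ?_⟩⟩ (homEvaluation_bijective hI)
  · ext q
    obtain ⟨r, rfl⟩ := hb.2 q
    simpa using congrArg (r • ·) hl
  · have : e LinearMap.id = 1 := by
      rw [LinearEquiv.symm_apply_eq]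
      simp
    simp [this]

/-- The evaluation map `Ω ⊗ Hom(Ω, N) → N` is bijective if `N` has finite injective dimension
and `Ext^i(Ω, N) = 0` for `i > 0`. -/
lemma IsDualizingModule.evaluation_bijective (hΩ : IsDualizingModule Ω) {N : Type u}
    [AddCommGroup N] [Module R N] {n : ℕ}
    (hN : HasInjectiveDimensionLT (ModuleCat.of R N) (n + 1))
    (hext : ∀ i, 0 < i → Subsingleton (Ext.{u} Ω (ModuleCat.of R N) i)) :
    TorVanishes Ω 0 (Ω →ₗ[R] N) ∧ Function.Bijective (evaluation Ω N) := by
  have := hΩ.finite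
  induction n generalizing N with
  | zero =>
    have : Injective (ModuleCat.of R N) := injective_iff_hasInjectiveDimensionLT_one.2 hN
    have hI : Module.Injective R N := Module.injective_module_of_injective_object R N
    exact ⟨torVanishes_hom_of_injective hI, hΩ.evaluation_bijective_of_injective hI⟩
  | succ n ih =>
    let I : ModuleCat.{u} R := Injective.under (ModuleCat.of R N)
    have hI' : Injective I := inferInstanceAs (Injective (Injective.under _))
    have hI : Module.Injective R I := Module.injective_module_of_injective_object R I
    let i : N →ₗ[R] I := (Injective.ι (ModuleCat.of R N)).hom
    have hi : Function.Injective i := (ModuleCat.mono_iff_injective _).1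
      (inferInstanceAs (Mono (Injective.ι (ModuleCat.of R N))))
    let Z := I ⧸ LinearMap.range i
    let p : I →ₗ[R] Z := (LinearMap.range i).mkQ
    have hip : Function.Exact i p := LinearMap.exact_map_mkQ_range i
    have hp : Function.Surjective p := Submodule.mkQ_surjective _
    have hS := shortExact_moduleCatMk hi hip hp
    have hI1 : HasInjectiveDimensionLT I (n + 1) := hasInjectiveDimensionLT_of_ge I 1 _ (by lia)
    have hextI (j : ℕ) (hj : 0 < j) : Subsingleton (Ext.{u} Ω I j) :=
      HasInjectiveDimensionLT.subsingleton I 1 j hj Ω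
    obtain ⟨hTZ, hZ⟩ := ih (N := Z) (hS.hasInjectiveDimensionLT_X₃ (n + 1) hI1 hN)
      fun j hj ↦ subsingleton_ext_X₃ hS Ω (hextI j hj) (hext (j + 1) j.succ_pos)
    have hTI : TorVanishes Ω 0 (Ω →ₗ[R] I) := torVanishes_hom_of_injective hI
    have hIbij := hΩ.evaluation_bijective_of_injective hI
    have hi' : Function.Injective (LinearMap.compRight (M := Ω) R i) := fun a b hab ↦ by
      ext t
      exact hi (congrArg (fun l ↦ l t) hab)
    have hp' : Function.Surjective (LinearMap.compRight (M := Ω) R p) := fun a ↦ by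
      obtain ⟨g, hg⟩ := exists_lift_of_subsingleton_ext hS (X := Ω) (hext 1 one_pos)
        (ModuleCat.ofHom a)
      exact ⟨g.hom, congrArg ModuleCat.Hom.hom hg⟩
    have hip' : Function.Exact (LinearMap.compRight (M := Ω) R i)
        (LinearMap.compRight (M := Ω) R p) := by
      refine fun a ↦ ⟨fun ha ↦ ?_, ?_⟩
      · have hr (t : Ω) : a t ∈ LinearMap.range i :=
          (hip _).1 (congrArg (fun l ↦ l t) ha)
        refine ⟨(LinearEquiv.ofInjective i hi).symm.toLinearMap ∘ₗ a.codRestrict _ hr, ?_⟩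
        ext t
        have := LinearEquiv.apply_symm_apply (LinearEquiv.ofInjective i hi) ⟨a t, hr t⟩
        exact congrArg Subtype.val this
      · rintro ⟨b, rfl⟩
        ext t
        exact hip.apply_apply_eq_zero (b t)
    refine ⟨hTZ.of_shortExact hTI hi' hip' hp', ?_⟩
    -- `Ω` is itself an admissible test module, as `Ext^i(Ω, Ω) = 0` for `i > 0`; so `Tor₁(Ω, Hom(Ω,
    -- Z)) = 0`.
    have hinj := (hTZ Ω hΩ.ext_eq_zero).lTensor_injective hi' hip' hp'
    have hex := lTensor_exact Ω hip' hp'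
    refine ⟨(injective_iff_map_eq_zero _).2 fun z hz ↦ ?_, fun y ↦ ?_⟩
    · refine hinj (hIbij.1 ?_)
      rw [evaluation_lTensor, hz]
      simp
    · obtain ⟨z, hz⟩ := hIbij.2 (i y)
      have hz0 : (LinearMap.compRight R p).lTensor Ω z = 0 := by
        refine hZ.1 ?_
        rw [evaluation_lTensor, hz, map_zero]
        exact hip.apply_apply_eq_zero y
      obtain ⟨w, rfl⟩ := (hex z).1 hz0
      refine ⟨w, hi ?_⟩
      rw [← hz, evaluation_lTensor]

end Counit

/-! ### Passage to the categorical adjunction -/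

section Equivalence

open TensorProduct

variable {R : Type u} [CommRing R] {Ω : ModuleCat.{u} R}

lemma IsTensorAcyclic.isIso_unit_app {M : ModuleCat.{u} R} (hM : IsTensorAcyclic Ω M) :
    IsIso ((ihom.adjunction Ω).unit.app M) := by
  rw [ConcreteCategory.isIso_iff_bijective]
  exact (ModuleCat.homLinearEquiv (S := R)).symm.bijective.comp hM.bijective

lemma isIso_counit_app {N : ModuleCat.{u} R} (hN : Function.Bijective (evaluation Ω N)) :
    IsIso ((ihom.adjunction Ω).counit.app N) := by
  rw [ConcreteCategory.isIso_iff_bijective]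
  let E : Ω ⊗[R] (Ω ⟶ N) →ₗ[R] N := ((ihom.ev Ω).app N).hom
  have hE : E = evaluation Ω N ∘ₗ
      (LinearEquiv.lTensor Ω (ModuleCat.homLinearEquiv (S := R) (M := Ω) (N := N))).toLinearMap :=
    TensorProduct.ext' fun t g ↦ congrArg (fun l ↦ l.hom (t ⊗ₜ g)) (ModuleCat.ihom_ev_app Ω N)
  change Function.Bijective E
  rw [hE]
  exact hN.comp (LinearEquiv.bijective _)

variable [IsLocalRing R] [IsNoetherianRing R]

lemma IsDualizingModule.isTensorAcyclic (hΩ : IsDualizingModule Ω) {M : ModuleCat.{u} R}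
    (hM : fgFiniteProjDim R M) : IsTensorAcyclic Ω M := by
  have := hM.1
  obtain ⟨n, hn⟩ := (projectiveDimension_ne_top_iff M).1 hM.2
  exact hΩ.isTensorAcyclic_of_hasProjectiveDimensionLT (n := n) hn

lemma IsDualizingModule.evaluation_bijective_of_fgFiniteInjDim (hΩ : IsDualizingModule Ω)
    {N : ModuleCat.{u} R} (hN : fgFiniteInjDim R N) :
    TorVanishes Ω 0 (Ω →ₗ[R] N) ∧ Function.Bijective (evaluation Ω N) := by
  have := hN.1
  obtain ⟨n, hn⟩ := (injectiveDimension_ne_top_iff N).1 hN.2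
  exact hΩ.evaluation_bijective (n := n) hn fun i hi ↦ hΩ.subsingleton_ext hn hi

lemma IsDualizingModule.fgFiniteInjDim_tensorLeft (hΩ : IsDualizingModule Ω)
    {M : ModuleCat.{u} R} (hM : fgFiniteProjDim R M) :
    fgFiniteInjDim R ((tensorLeft Ω).obj M) := by
  have := hM.1
  have := hΩ.finite
  refine ⟨inferInstanceAs (Module.Finite R (Ω ⊗[R] M)), ?_⟩
  obtain ⟨n, hn⟩ := (hΩ.isTensorAcyclic hM).exists_injectiveDimension
  exact (injectiveDimension_ne_top_iff _).2
    ⟨n, hasInjectiveDimensionLT_of_ge (ModuleCat.of R (Ω ⊗[R] M)) n (n + 1) (by lia)⟩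

lemma IsDualizingModule.fgFiniteProjDim_ihom (hΩ : IsDualizingModule Ω)
    {N : ModuleCat.{u} R} (hN : fgFiniteInjDim R N) :
    fgFiniteProjDim R ((ihom Ω).obj N) := by
  have := hN.1
  have := hΩ.finite
  have e : ModuleCat.of R (Ω →ₗ[R] N) ≅ (ihom Ω).obj N :=
    (ModuleCat.homLinearEquiv (S := R) (M := Ω) (N := N)).symm.toModuleIso
  refine ⟨Module.Finite.equiv e.toLinearEquiv, ?_⟩
  obtain ⟨n, hn⟩ := (injectiveDimension_ne_top_iff Ω).1 hΩ.injectiveDimension_ne_top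
  rw [← projectiveDimension_eq_of_iso e]
  refine (projectiveDimension_ne_top_iff _).2 ⟨n, ?_⟩
  refine (hΩ.evaluation_bijective_of_fgFiniteInjDim hN).1.hasProjectiveDimensionLT (k := n) ?_
  rwa [zero_add]

end Equivalence

end SharpEquivalence

theorem corollary5p11 {R : Type u} [CommRing R] [IsLocalRing R] [IsNoetherianRing R]
    (hR : SharpEquivalence.IsCohenMacaulay R)
    (Ω : ModuleCat.{u} R) (hΩ : SharpEquivalence.IsDualizingModule Ω) :
    ∃ (hF : ∀ M : ModuleCat.{u} R, SharpEquivalence.fgFiniteProjDim R M →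
          SharpEquivalence.fgFiniteInjDim R ((tensorLeft Ω).obj M))
      (hG : ∀ N : ModuleCat.{u} R, SharpEquivalence.fgFiniteInjDim R N →
          SharpEquivalence.fgFiniteProjDim R ((ihom Ω).obj N)),
      SharpEquivalence.IsAdjointEquivalence
        (SharpEquivalence.tensorHomAdjunction Ω (SharpEquivalence.fgFiniteProjDim R)
          (SharpEquivalence.fgFiniteInjDim R) hF hG) := by
  refine ⟨fun _ hM ↦ hΩ.fgFiniteInjDim_tensorLeft hM, fun _ hN ↦ hΩ.fgFiniteProjDim_ihom hN,
    ?_, ?_⟩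
  · rw [NatTrans.isIso_iff_isIso_app]
    intro M
    -- The inclusion of a full subcategory reflects isomorphisms, so the unit may be checked among
    -- all modules.
    rw [← isIso_iff_of_reflects_iso _ (SharpEquivalence.fgFiniteProjDim R).ι]
    have := (hΩ.isTensorAcyclic M.property).isIso_unit_app
    rw [SharpEquivalence.tensorHomAdjunction, Adjunction.map_restrictFullyFaithful_unit_app]
    exact IsIso.comp_isIso' this inferInstance
  · rw [NatTrans.isIso_iff_isIso_app]
    intro N
    rw [← isIso_iff_of_reflects_iso _ (SharpEquivalence.fgFiniteInjDim R).ι]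
    have := SharpEquivalence.isIso_counit_app
      (hΩ.evaluation_bijective_of_fgFiniteInjDim N.property).2
    rw [SharpEquivalence.tensorHomAdjunction, Adjunction.map_restrictFullyFaithful_counit_app]
    exact IsIso.comp_isIso' inferInstance (IsIso.comp_isIso' inferInstance this)
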